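/- Let $T$ be a finite-dimensional real vector space with a non-zero alternating bilinear form $(\cdot\,|\,\cdot)\colon T\times T\to\mathbb R$ and a trilinear product $[\cdot,\cdot,\cdot]\colon T\times T\times T\to T$ that make it a symplectic triple system, that is, for all $x,y,z,u,v,w\in T$, $$[x,y,z]=[y,x,z],$$ $$[x,y,z]-[x,z,y]=(x|z)\,y-(x|y)\,z+2(y|z)\,x,$$ $$[x,y,[u,v,w]]=[[x,y,u],v,w]+[u,[x,y,v],w]+[u,v,[x,y,w]],$$ $$([x,y,u]\,|\,v)=-(u\,|\,[x,y,v]).$$ Suppose that $T$ is simple: $[T,T,T]\neq 0$, and the only subspaces $I\subseteq T$ with $[T,T,I]+[T,I,T]\subseteq I$ are $0$ and $T$. Let $d_{x,y}=[x,y,\cdot\,]\in\mathrm{End}(T)$, and let $\mathfrak h=\mathrm{inder}(T)$ be the linear span of the maps $d_{x,y}$ ($x,y\in T$), which is a Lie algebra under the commutator. Let $V$ be a two-dimensional real vector space with a non-zero alternating bilinear form $\langle\cdot\,|\,\cdot\rangle$, and let $\mathfrak g(T)$ be the standard enveloping algebra of $T$, that is, the ($\mathbb Z/2$-graded) Lie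 algebra $$\mathfrak g(T)=\bigl(\mathfrak{sp}(V,\langle\cdot|\cdot\rangle)\oplus\mathfrak h\bigr)\oplus(V\otimes T)$$ whose even part $\mathfrak{sp}(V)\oplus\mathfrak h$ is a direct sum of Lie algebras, acting on the odd part $V\otimes T$ by $[\gamma+d,a\otimes x]=\gamma(a)\otimes x+a\otimes d(x)$, and in which $$[a\otimes x,b\otimes y]=(x|y)\,\gamma_{a,b}+\langle a|b\rangle\, d_{x,y},\qquad \gamma_{a,b}=\langle a|\cdot\rangle b+\langle b|\cdot\rangle a .$$ For a finite-dimensional real Lie algebra $\mathfrak a$ let $\mathrm{sign}(\mathfrak a)$ denote the signature of its Killing form $\kappa_{\mathfrak a}$, that is, the number of elements $v$ with $\kappa_{\mathfrak a}(v,v)>0$ minus the number of elements with $\kappa_{\mathfrak a}(v,v)<0$ in an orthogonal basis. If the Lie algebra $\mathfrak h$ is simple, then $$\mathrm{sign}(\mathfrak g(T))-\mathrm{sign}(\mathfrak h)=1 .$$ -/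

import Mathlib

open scoped TensorProduct

noncomputable section

attribute [local instance 100] LieRing.ofAssociativeRing

/-- The data of a symplectic triple system on the `F`-vector space `T`: a non-zero alternating
bilinear form `(x|y)` (`form x y`) and a trilinear product `[x,y,z]` (`triple x y z`), subject to
the four defining identities. -/
structure SymplecticTripleSystem (F T : Type*) [Field F] [AddCommGroup T] [Module F T] where
  form : LinearMap.BilinForm F T
  triple : T →ₗ[F] T →ₗ[F] T →ₗ[F] T
  form_isAlt : form.IsAlt
  form_ne_zero : form ≠ 0
  triple_comm : ∀ x y z : T, triple x y z = triple y x z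
  triple_sub : ∀ x y z : T, triple x y z - triple x z y
    = form x z • y - form x y • z + (2 * form y z) • x
  triple_triple : ∀ x y u v w : T, triple x y (triple u v w)
    = triple (triple x y u) v w + triple u (triple x y v) w + triple u v (triple x y w)
  form_triple : ∀ x y u v : T, form (triple x y u) v = - form u (triple x y v)

/-- A two-dimensional vector space `V` endowed with a non-zero alternating bilinear form. -/
structure SymplecticPlane (F V : Type*) [Field F] [AddCommGroup V] [Module F V] where
  form : LinearMap.BilinForm F V
  form_isAlt : form.IsAlt
  form_ne_zero : form ≠ 0
  finrank_eq_two : Module.finrank F V = 2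

namespace SymplecticPlane

variable {F V : Type*} [Field F] [AddCommGroup V] [Module F V] (P : SymplecticPlane F V)

/-- The symplectic Lie algebra `𝔰𝔭(V)`, the endomorphisms that are skew for the form. -/
abbrev sp : LieSubalgebra F (Module.End F V) := skewAdjointLieSubalgebra P.form

theorem mem_sp {f : Module.End F V} :
    f ∈ P.sp ↔ ∀ a b : V, P.form (f a) b + P.form a (f b) = 0 := by
  change f ∈ P.form.skewAdjointSubmodule ↔ _
  rw [LinearMap.mem_skewAdjointSubmodule]
  refine forall_congr' fun a => forall_congr' fun b => ?_
  simp [eq_neg_iff_add_eq_zero]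

theorem form_swap (a b : V) : P.form a b = - P.form b a := by
  rw [← P.form_isAlt.neg_eq a b, neg_neg]

/-- In a two-dimensional space the cyclic sum of `⟨a|b⟩c` vanishes. -/
theorem cyclic (a b c : V) :
    P.form a b • c + P.form b c • a + P.form c a • b = 0 := by
  have : Module.Finite F V := Module.finite_of_finrank_eq_succ P.finrank_eq_two
  let e := Module.finBasisOfFinrankEq F V P.finrank_eq_two
  have key : ∀ x y : V, P.form x y
      = (e.repr x 0 * e.repr y 1 - e.repr x 1 * e.repr y 0) * P.form (e 0) (e 1) := by
    intro x y
    conv_lhs => rw [← e.sum_repr x, ← e.sum_repr y]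
    simp only [Fin.sum_univ_two, map_add, LinearMap.add_apply, map_smul, LinearMap.smul_apply,
      smul_eq_mul, P.form_isAlt.self_eq_zero, P.form_swap (e 1) (e 0)]
    ring
  rw [key a b, key b c, key c a]
  apply e.repr.injective
  ext i
  fin_cases i <;> simp <;> ring

/-- `γ_{a,b} = ⟨a|·⟩ b + ⟨b|·⟩ a`, an element of `𝔰𝔭(V)` depending bilinearly on `a`, `b`. -/
def gamma : V →ₗ[F] V →ₗ[F] P.sp :=
  LinearMap.mk₂ F
    (fun a b => ⟨(P.form a).smulRight b + (P.form b).smulRight a, by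
      rw [P.mem_sp]
      intro c d
      simp only [LinearMap.add_apply, LinearMap.smulRight_apply, map_add, map_smul,
        LinearMap.smul_apply, smul_eq_mul, P.form_swap c]
      ring⟩)
    (fun a a' b => by ext c; simp [add_smul]; abel)
    (fun r a b => by ext c; simp [mul_smul, smul_comm r])
    (fun a b b' => by ext c; simp [add_smul]; abel)
    (fun r a b => by ext c; simp [mul_smul, smul_comm r])

theorem gamma_apply (a b c : V) :
    (P.gamma a b : Module.End F V) c = P.form a c • b + P.form b c • a := rfl

theorem gamma_comm (a b : V) : P.gamma a b = P.gamma b a := by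
  ext c
  simp only [gamma_apply]
  abel

end SymplecticPlane

namespace SymplecticTripleSystem

variable {F T V : Type*} [Field F] [AddCommGroup T] [Module F T] [AddCommGroup V] [Module F V]
  (S : SymplecticTripleSystem F T) (P : SymplecticPlane F V)

/-- A subspace `I` with `[T,T,I] + [T,I,T] ⊆ I`. -/
def IsIdeal (I : Submodule F T) : Prop :=
  ∀ x y i : T, i ∈ I → S.triple x y i ∈ I ∧ S.triple x i y ∈ I

/-- `[T,T,T] ≠ 0`, and `T` has no ideals other than `0` and `T`. -/
def IsSimple : Prop :=
  (∃ x y z : T, S.triple x y z ≠ 0) ∧ ∀ I : Submodule F T, S.IsIdeal I → I = ⊥ ∨ I = ⊤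

theorem form_swap (x y : T) : S.form x y = - S.form y x := by
  rw [← S.form_isAlt.neg_eq x y, neg_neg]

theorem triple_lie (x y u v : T) :
    ⁅S.triple x y, S.triple u v⁆
      = S.triple (S.triple x y u) v + S.triple u (S.triple x y v) := by
  ext w
  rw [LieRing.of_associative_ring_bracket]
  simp only [LinearMap.sub_apply, LinearMap.add_apply, Module.End.mul_apply]
  rw [S.triple_triple x y u v w]
  abel

/-- The Lie algebra of inner derivations: the linear span of the maps `d_{x,y} = [x,y,·]`,
with the commutator bracket of endomorphisms. -/
def inder : LieSubalgebra F (Module.End F T) where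
  __ := Submodule.span F {f : Module.End F T | ∃ x y : T, f = S.triple x y}
  lie_mem' := by
    intro f g hf hg
    simp only [AddSubsemigroup.mem_carrier, AddSubmonoid.mem_toSubsemigroup,
      Submodule.mem_toAddSubmonoid] at hf hg ⊢
    induction hf, hg using Submodule.span_induction₂ with
    | mem_mem f g hf hg =>
      obtain ⟨x, y, rfl⟩ := hf
      obtain ⟨u, v, rfl⟩ := hg
      rw [triple_lie]
      exact add_mem (Submodule.subset_span ⟨_, _, rfl⟩) (Submodule.subset_span ⟨_, _, rfl⟩)
    | zero_left => simp
    | zero_right => simp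
    | add_left f f' g _ _ _ h h' => rw [add_lie]; exact add_mem h h'
    | add_right f g g' _ _ _ h h' => rw [lie_add]; exact add_mem h h'
    | smul_left r f g _ _ h => rw [smul_lie]; exact Submodule.smul_mem _ _ h
    | smul_right r f g _ _ h => rw [lie_smul]; exact Submodule.smul_mem _ _ h

theorem mem_inder {f : Module.End F T} :
    f ∈ S.inder ↔ f ∈ Submodule.span F {f : Module.End F T | ∃ x y : T, f = S.triple x y} :=
  Iff.rfl

/-- The inner derivation `d_{x,y} = [x,y,·]`, depending bilinearly on `x`, `y`. -/
def d : T →ₗ[F] T →ₗ[F] S.inder :=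
  LinearMap.mk₂ F (fun x y => ⟨S.triple x y, Submodule.subset_span ⟨x, y, rfl⟩⟩)
    (fun x x' y => by ext z; simp) (fun r x y => by ext z; simp)
    (fun x y y' => by ext z; simp) (fun r x y => by ext z; simp)

theorem d_apply (x y z : T) : (S.d x y : Module.End F T) z = S.triple x y z := rfl

theorem d_comm (x y : T) : S.d x y = S.d y x := by
  ext z
  exact S.triple_comm x y z

theorem inder_form (f : S.inder) (x y : T) :
    S.form ((f : Module.End F T) x) y + S.form x ((f : Module.End F T) y) = 0 := by
  obtain ⟨f, hf⟩ := f
  simp only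
  rw [S.mem_inder] at hf
  induction hf using Submodule.span_induction with
  | mem f hf => obtain ⟨u, v, rfl⟩ := hf; rw [S.form_triple]; ring
  | zero => simp
  | add f g _ _ hf hg =>
    simp only [LinearMap.add_apply, map_add]
    linear_combination hf + hg
  | smul r f _ hf =>
    simp only [LinearMap.smul_apply, map_smul, smul_eq_mul]
    linear_combination r * hf

theorem inder_lie_d (f : S.inder) (x y : T) :
    ⁅f, S.d x y⁆ = S.d ((f : Module.End F T) x) y + S.d x ((f : Module.End F T) y) := by
  obtain ⟨f, hf⟩ := f
  apply Subtype.ext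
  change ⁅f, S.triple x y⁆ = S.triple (f x) y + S.triple x (f y)
  rw [S.mem_inder] at hf
  induction hf using Submodule.span_induction with
  | mem f hf => obtain ⟨u, v, rfl⟩ := hf; exact S.triple_lie u v x y
  | zero => simp
  | add f g _ _ hf hg =>
    simp only [LinearMap.add_apply, map_add, add_lie, hf, hg]
    abel
  | smul r f _ hf =>
    simp only [LinearMap.smul_apply, map_smul, smul_lie, hf, smul_add]

theorem coe_add_End {M : Type*} [AddCommGroup M] [Module F M]
    {L : LieSubalgebra F (Module.End F M)} (f g : L) :
    ((f + g : L) : Module.End F M) = f + g := rfl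

theorem coe_smul_End {M : Type*} [AddCommGroup M] [Module F M]
    {L : LieSubalgebra F (Module.End F M)} (r : F) (f : L) :
    ((r • f : L) : Module.End F M) = r • (f : Module.End F M) := rfl

/-- The natural action of `𝔰𝔭(V) ⊕ inder(T)` on `V ⊗ T`:
`(γ + f) · (a ⊗ x) = γ(a) ⊗ x + a ⊗ f(x)`. -/
def act : (P.sp × S.inder) →ₗ[F] Module.End F (V ⊗[F] T) where
  toFun e := (e.1 : Module.End F V).rTensor T + (e.2 : Module.End F T).lTensor V
  map_add' e e' := by
    simp only [Prod.fst_add, Prod.snd_add, coe_add_End, LinearMap.rTensor_add,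
      LinearMap.lTensor_add]
    abel
  map_smul' r e := by
    simp only [Prod.smul_fst, Prod.smul_snd, coe_smul_End, LinearMap.rTensor_smul,
      LinearMap.lTensor_smul, smul_add, RingHom.id_apply]

theorem act_tmul (e : P.sp × S.inder) (a : V) (x : T) :
    S.act P e (a ⊗ₜ x)
      = (e.1 : Module.End F V) a ⊗ₜ x + a ⊗ₜ (e.2 : Module.End F T) x := rfl

/-- The product of odd elements: `[a ⊗ x, b ⊗ y] = (x|y) γ_{a,b} + ⟨a|b⟩ d_{x,y}`. -/
def oddMul : (V ⊗[F] T) →ₗ[F] (V ⊗[F] T) →ₗ[F] (P.sp × S.inder) :=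
  (TensorProduct.map₂ P.gamma S.form).compr₂
      (LinearMap.inl F P.sp S.inder ∘ₗ (TensorProduct.rid F P.sp).toLinearMap)
    + (TensorProduct.map₂ P.form S.d).compr₂
      (LinearMap.inr F P.sp S.inder ∘ₗ (TensorProduct.lid F S.inder).toLinearMap)

theorem oddMul_tmul (a b : V) (x y : T) :
    S.oddMul P (a ⊗ₜ x) (b ⊗ₜ y) = (S.form x y • P.gamma a b, P.form a b • S.d x y) := by
  simp [oddMul]

theorem oddMul_swap (u v : V ⊗[F] T) : S.oddMul P u v = - S.oddMul P v u := by
  induction u with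
  | zero => simp
  | add u u' h h' => rw [map_add, LinearMap.add_apply, h, h', map_add, neg_add]
  | tmul a x =>
    induction v with
    | zero => simp
    | add u u' h h' => rw [map_add, h, h', map_add, LinearMap.add_apply, neg_add]
    | tmul b y =>
      rw [oddMul_tmul, oddMul_tmul, S.form_swap x y, P.form_swap a b, P.gamma_comm a b,
        S.d_comm x y]
      simp

theorem oddMul_self (u : V ⊗[F] T) : S.oddMul P u u = 0 := by
  induction u with
  | zero => simp
  | add u v h h' => simp [h, h', S.oddMul_swap P v u]
  | tmul a x =>
    rw [oddMul_tmul, S.form_isAlt.self_eq_zero, P.form_isAlt.self_eq_zero]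
    simp

theorem act_lie (e e' : P.sp × S.inder) (u : V ⊗[F] T) :
    S.act P ⁅e, e'⁆ u = S.act P e (S.act P e' u) - S.act P e' (S.act P e u) := by
  induction u with
  | zero => simp
  | add u v h h' => simp only [map_add, h, h']; abel
  | tmul a x =>
    simp only [act_tmul, map_add, LieAlgebra.Prod.bracket_apply, LieSubalgebra.coe_bracket,
      LieRing.of_associative_ring_bracket, LinearMap.sub_apply, Module.End.mul_apply,
      TensorProduct.sub_tmul, TensorProduct.tmul_sub]
    abel

theorem sp_lie_gamma (f : P.sp) (a b : V) :
    ⁅f, P.gamma a b⁆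
      = P.gamma ((f : Module.End F V) a) b + P.gamma a ((f : Module.End F V) b) := by
  have hf := P.mem_sp.1 f.2
  ext c
  simp only [LieSubalgebra.coe_bracket, LieRing.of_associative_ring_bracket,
    LinearMap.sub_apply, Module.End.mul_apply, P.gamma_apply, map_add, map_smul,
    coe_add_End, LinearMap.add_apply]
  rw [eq_neg_of_add_eq_zero_left (hf a c), eq_neg_of_add_eq_zero_left (hf b c)]
  simp only [neg_smul]
  abel

theorem lie_oddMul (e : P.sp × S.inder) (u v : V ⊗[F] T) :
    ⁅e, S.oddMul P u v⁆ = S.oddMul P (S.act P e u) v + S.oddMul P u (S.act P e v) := by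
  induction u with
  | zero => simp
  | add u u' h h' =>
    simp only [map_add, LinearMap.add_apply, lie_add, h, h']
    abel
  | tmul a x =>
    induction v with
    | zero => simp
    | add v v' h h' =>
      simp only [map_add, lie_add, h, h']
      abel
    | tmul b y =>
      have h1 := eq_neg_of_add_eq_zero_left (P.mem_sp.1 e.1.2 a b)
      have h2 := eq_neg_of_add_eq_zero_left (S.inder_form e.2 x y)
      simp only [act_tmul, map_add, LinearMap.add_apply, oddMul_tmul,
        LieAlgebra.Prod.bracket_apply, lie_smul, sp_lie_gamma, inder_lie_d, h1, h2]
      ext1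
      · simp only [Prod.fst_add]
        module
      · simp only [Prod.snd_add]
        module

theorem act_oddMul (u v w : V ⊗[F] T) :
    S.act P (S.oddMul P u v) w + S.act P (S.oddMul P v w) u + S.act P (S.oddMul P w u) v = 0 := by
  induction u with
  | zero => simp
  | add u u' h h' =>
    simp only [map_add, LinearMap.add_apply]
    rw [← add_zero (0 : V ⊗[F] T)]
    nth_rewrite 1 [← h]
    rw [← h']
    abel
  | tmul a x =>
  induction v with
  | zero => simp
  | add u u' h h' =>
    simp only [map_add, LinearMap.add_apply]
    rw [← add_zero (0 : V ⊗[F] T)]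
    nth_rewrite 1 [← h]
    rw [← h']
    abel
  | tmul b y =>
  induction w with
  | zero => simp
  | add u u' h h' =>
    simp only [map_add, LinearMap.add_apply]
    rw [← add_zero (0 : V ⊗[F] T)]
    nth_rewrite 1 [← h]
    rw [← h']
    abel
  | tmul c z =>
    have hc : ∀ w : T, P.form a b • (c ⊗ₜ[F] w) + P.form b c • (a ⊗ₜ[F] w)
        + P.form c a • (b ⊗ₜ[F] w) = 0 := by
      intro w
      rw [TensorProduct.smul_tmul', TensorProduct.smul_tmul', TensorProduct.smul_tmul',
        ← TensorProduct.add_tmul, ← TensorProduct.add_tmul, P.cyclic, TensorProduct.zero_tmul]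
    have h1 : S.triple y z x = S.triple x y z
        - (S.form y z • x - S.form y x • z + (2 * S.form x z) • y) := by
      rw [← S.triple_sub y x z, S.triple_comm x y z]
      abel
    have h2 : S.triple z x y = S.triple x y z
        - (S.form x z • y - S.form x y • z + (2 * S.form y z) • x) := by
      rw [← S.triple_sub x y z, S.triple_comm z x y]
      abel
    simp only [act_tmul, oddMul_tmul, coe_smul_End, LinearMap.smul_apply, P.gamma_apply,
      S.d_apply, h1, h2, TensorProduct.add_tmul, TensorProduct.tmul_add, TensorProduct.tmul_sub,
      TensorProduct.tmul_smul, ← TensorProduct.smul_tmul', smul_add, smul_sub]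
    rw [P.form_swap a c, P.form_swap b a, P.form_swap c b, S.form_swap y x, S.form_swap z x]
    linear_combination (norm := module) hc (S.triple x y z) - S.form y z • hc x - S.form x z • hc y

theorem leibniz_even (e f g : P.sp × S.inder) (u v w : V ⊗[F] T) :
    ⁅e, ⁅f, g⁆ + S.oddMul P v w⁆ + S.oddMul P u (S.act P f w - S.act P g v)
      = ⁅⁅e, f⁆ + S.oddMul P u v, g⁆ + S.oddMul P (S.act P e v - S.act P f u) w
        + (⁅f, ⁅e, g⁆ + S.oddMul P u w⁆ + S.oddMul P v (S.act P e w - S.act P g u)) := by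
  have h1 := leibniz_lie e f g
  have h2 := S.lie_oddMul P e v w
  have h3 := S.lie_oddMul P f u w
  have h4 : ⁅S.oddMul P u v, g⁆
      = -(-S.oddMul P v (S.act P g u) + S.oddMul P u (S.act P g v)) := by
    rw [← lie_skew, S.lie_oddMul, S.oddMul_swap P (S.act P g u) v]
  rw [lie_add, lie_add, add_lie, h1, h2, h3, h4]
  simp only [map_sub, LinearMap.sub_apply]
  abel

theorem leibniz_odd (e f g : P.sp × S.inder) (u v w : V ⊗[F] T) :
    S.act P e (S.act P f w - S.act P g v) - S.act P (⁅f, g⁆ + S.oddMul P v w) u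
      = S.act P (⁅e, f⁆ + S.oddMul P u v) w - S.act P g (S.act P e v - S.act P f u)
        + (S.act P f (S.act P e w - S.act P g u) - S.act P (⁅e, g⁆ + S.oddMul P u w) v) := by
  have h := S.act_oddMul P u v w
  rw [S.oddMul_swap P w u, map_neg, LinearMap.neg_apply] at h
  have h' : S.act P (S.oddMul P v w) u
      = S.act P (S.oddMul P u w) v - S.act P (S.oddMul P u v) w := by
    rw [eq_sub_iff_add_eq, ← sub_eq_zero, ← h]
    abel
  simp only [map_add, map_sub, LinearMap.add_apply, act_lie, h']
  abel

/-- The underlying space `(𝔰𝔭(V) ⊕ inder(T)) ⊕ (V ⊗ T)` of the standard enveloping algebra. -/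
def EnvelopingAlgebra (S : SymplecticTripleSystem F T) (P : SymplecticPlane F V) : Type _ :=
  (P.sp × S.inder) × (V ⊗[F] T)

namespace EnvelopingAlgebra

instance : AddCommGroup (S.EnvelopingAlgebra P) :=
  inferInstanceAs (AddCommGroup ((P.sp × S.inder) × (V ⊗[F] T)))

instance : Module F (S.EnvelopingAlgebra P) :=
  inferInstanceAs (Module F ((P.sp × S.inder) × (V ⊗[F] T)))

variable {S P}

/-- The even component. -/
def even : S.EnvelopingAlgebra P →ₗ[F] (P.sp × S.inder) :=
  LinearMap.fst F (P.sp × S.inder) (V ⊗[F] T)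

/-- The odd component. -/
def odd : S.EnvelopingAlgebra P →ₗ[F] (V ⊗[F] T) :=
  LinearMap.snd F (P.sp × S.inder) (V ⊗[F] T)

theorem ext {x y : S.EnvelopingAlgebra P} (h : even x = even y) (h' : odd x = odd y) : x = y :=
  Prod.ext h h'

instance : Bracket (S.EnvelopingAlgebra P) (S.EnvelopingAlgebra P) where
  bracket x y := (⁅even x, even y⁆ + S.oddMul P (odd x) (odd y),
    S.act P (even x) (odd y) - S.act P (even y) (odd x))

theorem even_lie (x y : S.EnvelopingAlgebra P) :
    even ⁅x, y⁆ = ⁅even x, even y⁆ + S.oddMul P (odd x) (odd y) := rfl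

theorem odd_lie (x y : S.EnvelopingAlgebra P) :
    odd ⁅x, y⁆ = S.act P (even x) (odd y) - S.act P (even y) (odd x) := rfl

instance : LieRing (S.EnvelopingAlgebra P) where
  add_lie x y z := by
    apply ext
    · simp only [even_lie, map_add, add_lie, LinearMap.add_apply]; abel
    · simp only [odd_lie, map_add, LinearMap.add_apply]; abel
  lie_add x y z := by
    apply ext
    · simp only [even_lie, map_add, lie_add]; abel
    · simp only [odd_lie, map_add, LinearMap.add_apply]; abel
  lie_self x := by
    apply ext
    · rw [even_lie, lie_self, oddMul_self, zero_add, map_zero]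
    · rw [odd_lie, sub_self, map_zero]
  leibniz_lie x y z := by
    apply ext
    · simp only [even_lie, odd_lie]
      exact S.leibniz_even P _ _ _ _ _ _
    · simp only [even_lie, odd_lie]
      exact S.leibniz_odd P _ _ _ _ _ _

instance : LieAlgebra F (S.EnvelopingAlgebra P) where
  lie_smul r x y := by
    apply ext
    · simp only [even_lie, map_smul, lie_smul, smul_add]
    · simp only [odd_lie, map_smul, smul_sub, LinearMap.smul_apply]

end EnvelopingAlgebra

end SymplecticTripleSystem

/-- The signature of the Killing form of a finite-dimensional real Lie algebra: the number of
elements of positive norm minus the number of elements of negative norm in an orthogonal basis. -/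
def killingSignature (L : Type*) [LieRing L] [LieAlgebra ℝ L] : ℤ :=
  (sigPos (LinearMap.BilinMap.toQuadraticMap (killingForm ℝ L)) : ℤ)
    - (sigNeg (LinearMap.BilinMap.toQuadraticMap (killingForm ℝ L)) : ℤ)

end

/-! Write `n = dim T`. The Killing form of `𝔤(T)` splits orthogonally over `𝔰𝔭(V)`, `𝔥` and `V ⊗ T`.
On `𝔰𝔭(V)` it is `n + 4` times the trace form, of signature `2 - 1 = 1`. On `V ⊗ T` it is a multiple
of the product of the two alternating forms, and a map of `V` reversing `⟨·|·⟩` shows that its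
signature is zero. On `𝔥` it is `inderForm`, that is, `κ_𝔥(f, g) + 2 tr_T(fg)`. Hence
`killingSignature_eq`, and it remains to see that `inderForm` and `κ_𝔥` have the same signature.

Both forms are invariant, and `inderForm` is nondegenerate, so they are related by an endomorphism
in the centroid of the simple algebra `𝔥`. If this is not a scalar, it yields a complex structure
that is symmetric for both forms, and both signatures vanish
(`LieAlgebra.IsSimple.eq_smul_or_signature_eq_zero`). Otherwise `κ_𝔥 = r • inderForm`, and one needs
`r > 0`. A Casimir trace (`finrank_mul_eq_of_killingForm_eq`) gives `(n + 4)(1 - r) dim 𝔥 = n(n +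
1)`, so `r > 0` amounts to `n(n + 1) < (n + 4) dim 𝔥`. This follows from `n ≤ dim 𝔥 + 1`
(`finrank_le_finrank_inder_add_one`): for a suitable `x` the map `y ↦ d_{x,y}` has kernel of
dimension at most one. -/

open scoped TensorProduct

noncomputable section

attribute [local instance 100] LieRing.ofAssociativeRing


/-! ### Signatures of real quadratic forms -/

section Signature

variable {M N : Type*} [AddCommGroup M] [Module ℝ M] [AddCommGroup N] [Module ℝ N]

/-- The signature of a real quadratic form. -/
def signature (Q : QuadraticForm ℝ M) : ℤ := (sigPos Q : ℤ) - (sigNeg Q : ℤ)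

theorem signature_congr {Q : QuadraticForm ℝ M} {Q' : QuadraticForm ℝ N}
    (h : QuadraticMap.Equivalent Q Q') : signature Q = signature Q' := by
  rw [signature, signature, h.sigPos_eq, h.sigNeg_eq]

theorem signature_neg (Q : QuadraticForm ℝ M) : signature (-Q) = -signature Q := by
  simp [signature]

theorem signature_eq_zero_of_equivalent_neg {Q : QuadraticForm ℝ M}
    (h : QuadraticMap.Equivalent Q (-Q)) : signature Q = 0 := by
  have := signature_congr h
  rw [signature_neg] at this
  omega

theorem signature_smul (Q : QuadraticForm ℝ M) {r : ℝ} (hr : 0 < r) :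
    signature (r • Q) = signature Q := by
  refine signature_congr ⟨⟨LinearEquiv.smulOfNeZero ℝ M (√r) (Real.sqrt_pos.2 hr).ne', ?_⟩⟩
  intro m
  change Q (√r • m) = r • Q m
  rw [QuadraticMap.map_smul, Real.mul_self_sqrt hr.le]

theorem signature_weightedSumSquares {ι : Type*} [Fintype ι] (w : ι → ℝ) :
    signature (QuadraticMap.weightedSumSquares ℝ w)
      = ({i | 0 < w i}.ncard : ℤ) - ({i | w i < 0}.ncard : ℤ) := by
  rw [signature, QuadraticForm.sigPos_weightedSumSquares,
    QuadraticForm.sigNeg_weightedSumSquares]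

/-- Diagonalise both forms; the product is then diagonal with the two weight families joined, and
signs are counted. -/
theorem signature_prod [FiniteDimensional ℝ M] [FiniteDimensional ℝ N]
    (Q : QuadraticForm ℝ M) (Q' : QuadraticForm ℝ N) :
    signature (QuadraticMap.prod Q Q') = signature Q + signature Q' := by
  have : Invertible (2 : ℝ) := invertibleOfNonzero two_ne_zero
  obtain ⟨w, ⟨e⟩⟩ := Q.equivalent_weightedSumSquares
  obtain ⟨w', ⟨e'⟩⟩ := Q'.equivalent_weightedSumSquares
  rw [signature_congr ⟨e⟩, signature_congr ⟨e'⟩, signature_congr ⟨e.prod e'⟩]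
  have h : QuadraticMap.Equivalent (QuadraticMap.weightedSumSquares ℝ (Sum.elim w w'))
      (QuadraticMap.prod (QuadraticMap.weightedSumSquares ℝ w)
        (QuadraticMap.weightedSumSquares ℝ w')) := by
    refine ⟨⟨LinearEquiv.sumArrowLequivProdArrow _ _ ℝ ℝ, ?_⟩⟩
    intro m
    simp [QuadraticMap.weightedSumSquares_apply, Fintype.sum_sum_type,
      LinearEquiv.sumArrowLequivProdArrow]
  rw [← signature_congr h]
  simp only [signature_weightedSumSquares]
  have key : ∀ p : ℝ → Prop, {i | p (Sum.elim w w' i)}.ncard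
      = {i | p (w i)}.ncard + {i | p (w' i)}.ncard := by
    intro p
    have : {i | p (Sum.elim w w' i)}
        = Sum.inl '' {i | p (w i)} ∪ Sum.inr '' {i | p (w' i)} := by
      ext i
      cases i <;> simp
    rw [this, Set.ncard_union_eq, Set.ncard_image_of_injective _ Sum.inl_injective,
      Set.ncard_image_of_injective _ Sum.inr_injective]
    · rw [Set.disjoint_left]
      rintro _ ⟨a, _, rfl⟩ ⟨b, _, hb⟩
      exact Sum.inr_ne_inl hb
  rw [key (fun x => 0 < x), key (fun x => x < 0)]
  push_cast
  ring

end Signature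


/-! ### The algebra `𝔰𝔭(V)`: coordinates, trace form and Killing form -/

namespace SymplecticPlane

variable {V : Type*} [AddCommGroup V] [Module ℝ V]

theorem finiteDimensional (P : SymplecticPlane ℝ V) : FiniteDimensional ℝ V :=
  Module.finite_of_finrank_eq_succ P.finrank_eq_two

theorem exists_form_eq_one (P : SymplecticPlane ℝ V) : ∃ a b : V, P.form a b = 1 := by
  obtain ⟨a, b, h⟩ : ∃ a b : V, P.form a b ≠ 0 := by
    by_contra! h
    exact P.form_ne_zero (LinearMap.ext₂ h)
  exact ⟨(P.form a b)⁻¹ • a, b, by simp [h]⟩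

variable {P : SymplecticPlane ℝ V} {a b : V} (h : P.form a b = 1)

include h in
theorem eq_form_smul_add (v : V) : v = P.form v b • a + P.form a v • b := by
  have := P.cyclic a b v
  rw [h, one_smul, P.form_swap b v, P.form_swap v a] at this
  linear_combination (norm := module) this

theorem form_apply_right (f : P.sp) (c d : V) :
    P.form c ((f : Module.End ℝ V) d) = -P.form ((f : Module.End ℝ V) c) d := by
  linear_combination P.mem_sp.1 f.2 c d

include h in
theorem sp_ext {f g : P.sp} (ha : (f : Module.End ℝ V) a = (g : Module.End ℝ V) a)
    (hb : (f : Module.End ℝ V) b = (g : Module.End ℝ V) b) : f = g := by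
  ext v
  rw [eq_form_smul_add h v]
  simp only [map_add, map_smul, ha, hb]

include h in
theorem sp_apply_left (f : P.sp) : (f : Module.End ℝ V) a
    = P.form ((f : Module.End ℝ V) a) b • a + P.form a ((f : Module.End ℝ V) a) • b :=
  eq_form_smul_add h _

include h in
theorem sp_apply_right (f : P.sp) : (f : Module.End ℝ V) b
    = P.form ((f : Module.End ℝ V) b) b • a - P.form ((f : Module.End ℝ V) a) b • b := by
  have := eq_form_smul_add h ((f : Module.End ℝ V) b)
  rwa [form_apply_right f a b, neg_smul, ← sub_eq_add_neg] at this

/-- Coordinates on `𝔰𝔭(V)` given by a symplectic basis `a`, `b` of `V`. -/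
def spEquiv : P.sp ≃ₗ[ℝ] (Fin 3 → ℝ) where
  toFun f := ![P.form ((f : Module.End ℝ V) a) b, P.form a ((f : Module.End ℝ V) a),
    P.form ((f : Module.End ℝ V) b) b]
  map_add' f g := by ext i; fin_cases i <;> simp
  map_smul' r f := by ext i; fin_cases i <;> simp
  invFun c := -(c 0) • P.gamma a b + (c 2 / 2) • P.gamma a a - (c 1 / 2) • P.gamma b b
  left_inv f := by
    have h' : P.form b a = -1 := by rw [P.form_swap, h]
    apply sp_ext h
    · conv_rhs => rw [sp_apply_left h f]
      simp [gamma_apply, h', P.form_isAlt.self_eq_zero]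
      module
    · conv_rhs => rw [sp_apply_right h f]
      simp [gamma_apply, h, P.form_isAlt.self_eq_zero]
      module
  right_inv c := by
    have h' : P.form b a = -1 := by rw [P.form_swap, h]
    ext i
    fin_cases i <;> simp [gamma_apply, h, h', P.form_isAlt.self_eq_zero]

theorem spEquiv_zero (f : P.sp) :
    spEquiv h f 0 = P.form ((f : Module.End ℝ V) a) b := rfl

theorem spEquiv_one (f : P.sp) :
    spEquiv h f 1 = P.form a ((f : Module.End ℝ V) a) := rfl

theorem spEquiv_two (f : P.sp) :
    spEquiv h f 2 = P.form ((f : Module.End ℝ V) b) b := rfl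

theorem spEquiv_symm_apply (c : Fin 3 → ℝ) : (spEquiv h).symm c
    = -(c 0) • P.gamma a b + (c 2 / 2) • P.gamma a a - (c 1 / 2) • P.gamma b b := rfl

theorem spEquiv_lie (f g : P.sp) : spEquiv h ⁅f, g⁆
    = ![spEquiv h f 2 * spEquiv h g 1 - spEquiv h f 1 * spEquiv h g 2,
        2 * (spEquiv h f 1 * spEquiv h g 0 - spEquiv h f 0 * spEquiv h g 1),
        2 * (spEquiv h f 0 * spEquiv h g 2 - spEquiv h f 2 * spEquiv h g 0)] := by
  have hl := sp_apply_left h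
  have hr := sp_apply_right h
  simp only [← spEquiv_zero h, ← spEquiv_one h, ← spEquiv_two h] at hl hr
  ext i
  fin_cases i
  · change P.form ((⁅f, g⁆ : P.sp).1 a) b = _
    simp only [LieSubalgebra.coe_bracket, LieRing.of_associative_ring_bracket,
      LinearMap.sub_apply, Module.End.mul_apply, hl, hr, map_add, map_smul]
    simp [h, P.form_isAlt.self_eq_zero]
    ring
  · change P.form a ((⁅f, g⁆ : P.sp).1 a) = _
    simp only [LieSubalgebra.coe_bracket, LieRing.of_associative_ring_bracket,
      LinearMap.sub_apply, Module.End.mul_apply, hl, hr, map_add, map_smul]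
    simp [h, P.form_isAlt.self_eq_zero]
    ring
  · change P.form ((⁅f, g⁆ : P.sp).1 b) b = _
    simp only [LieSubalgebra.coe_bracket, LieRing.of_associative_ring_bracket,
      LinearMap.sub_apply, Module.End.mul_apply, hl, hr, map_sub, map_smul]
    simp [h, P.form_isAlt.self_eq_zero]
    ring

variable (P) in
-- The composite is a sum of two rank-one maps, whose traces agree because `f` is skew.
theorem trace_gamma_comp (a b : V) (f : P.sp) :
    LinearMap.trace ℝ V ((P.gamma a b : Module.End ℝ V) ∘ₗ (f : Module.End ℝ V))
      = 2 * P.form a ((f : Module.End ℝ V) b) := by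
  have := P.finiteDimensional
  have e : (P.gamma a b : Module.End ℝ V) ∘ₗ (f : Module.End ℝ V)
      = (P.form a ∘ₗ (f : Module.End ℝ V)).smulRight b
        + (P.form b ∘ₗ (f : Module.End ℝ V)).smulRight a := by
    ext c; simp [gamma_apply]
  rw [e, map_add, LinearMap.trace_smulRight, LinearMap.trace_smulRight]
  simp only [LinearMap.comp_apply]
  rw [form_apply_right f b a, P.form_swap _ a]
  ring

theorem trace_comp_eq (f g : P.sp) :
    LinearMap.trace ℝ V ((f : Module.End ℝ V) ∘ₗ (g : Module.End ℝ V))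
      = 2 * (spEquiv h f 0 * spEquiv h g 0) + spEquiv h f 1 * spEquiv h g 2
        + spEquiv h f 2 * spEquiv h g 1 := by
  obtain ⟨c, rfl⟩ := (spEquiv h).symm.surjective f
  have ha : P.form a ((g : Module.End ℝ V) b) = - spEquiv h g 0 := by
    rw [form_apply_right]; rfl
  have hb : P.form b ((g : Module.End ℝ V) b) = - spEquiv h g 2 := by
    rw [P.form_swap]; rfl
  have e : ((-(c 0) • P.gamma a b + (c 2 / 2) • P.gamma a a - (c 1 / 2) • P.gamma b b : P.sp) :
      Module.End ℝ V) ∘ₗ (g : Module.End ℝ V)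
      = -(c 0) • ((P.gamma a b : Module.End ℝ V) ∘ₗ (g : Module.End ℝ V))
        + (c 2 / 2) • ((P.gamma a a : Module.End ℝ V) ∘ₗ (g : Module.End ℝ V))
        - (c 1 / 2) • ((P.gamma b b : Module.End ℝ V) ∘ₗ (g : Module.End ℝ V)) := by
    ext v; simp
  rw [LinearEquiv.apply_symm_apply, spEquiv_symm_apply, e]
  simp only [map_sub, map_add, map_smul, trace_gamma_comp, ha, hb, ← spEquiv_one h, smul_eq_mul]
  ring

/-- A linear involution of `V` that reverses the sign of the form. -/
theorem exists_form_neg (P : SymplecticPlane ℝ V) :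
    ∃ φ : V ≃ₗ[ℝ] V, ∀ c d, P.form (φ c) (φ d) = -P.form c d := by
  obtain ⟨a, b, h⟩ := P.exists_form_eq_one
  have h' : P.form b a = -1 := by rw [P.form_swap, h]
  let φ : V →ₗ[ℝ] V := (P.form.flip b).smulRight b + (P.form a).smulRight a
  have hφ : ∀ c, φ c = P.form c b • b + P.form a c • a := fun c => rfl
  have hi : φ ∘ₗ φ = LinearMap.id := by
    ext c
    conv_rhs => rw [LinearMap.id_apply, eq_form_smul_add h c]
    simp [hφ, h, P.form_isAlt.self_eq_zero]
    abel
  refine ⟨LinearEquiv.ofLinearMap φ φ hi hi, fun c d => ?_⟩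
  change P.form (φ c) (φ d) = _
  conv_rhs => rw [eq_form_smul_add h c, eq_form_smul_add h d]
  simp [hφ, h, h', P.form_isAlt.self_eq_zero]
  ring

theorem exists_form_ne_zero (P : SymplecticPlane ℝ V) {c : V} (hc : c ≠ 0) :
    ∃ d, P.form c d ≠ 0 := by
  obtain ⟨a, b, h⟩ := P.exists_form_eq_one
  by_contra! h0
  apply hc
  rw [eq_form_smul_add h c, h0, P.form_swap, h0, neg_zero, zero_smul, zero_smul, add_zero]

theorem killingForm_sp (P : SymplecticPlane ℝ V) (f g : P.sp) : killingForm ℝ P.sp f g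
    = 4 * LinearMap.trace ℝ V ((f : Module.End ℝ V) ∘ₗ (g : Module.End ℝ V)) := by
  obtain ⟨a, b, h⟩ := P.exists_form_eq_one
  rw [trace_comp_eq h, killingForm_apply_apply,
    LinearMap.trace_eq_matrix_trace ℝ (Module.Basis.ofEquivFun (spEquiv h))]
  simp only [Matrix.trace, Fin.sum_univ_three, Matrix.diag_apply, LinearMap.toMatrix_apply,
    LinearMap.comp_apply, LieAlgebra.ad_apply, Module.Basis.ofEquivFun_repr_apply, spEquiv_lie,
    Module.Basis.coe_ofEquivFun, LinearEquiv.apply_symm_apply]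
  simp
  ring

theorem signature_trace_sp (P : SymplecticPlane ℝ V) {Q : QuadraticForm ℝ P.sp}
    {r : ℝ} (hr : 0 < r) (hQ : ∀ f : P.sp, Q f
      = r * LinearMap.trace ℝ V ((f : Module.End ℝ V) ∘ₗ (f : Module.End ℝ V))) :
    signature Q = 1 := by
  obtain ⟨a, b, h⟩ := P.exists_form_eq_one
  -- The form is `2r(c₀² + c₁c₂)`; half-sum and half-difference turn the hyperbolic term `c₁c₂` into
  -- a difference of squares.
  let e : (Fin 3 → ℝ) ≃ₗ[ℝ] (Fin 3 → ℝ) :=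
    { toFun c := ![c 0, (c 1 + c 2) / 2, (c 1 - c 2) / 2]
      map_add' c d := by ext i; fin_cases i <;> simp <;> ring
      map_smul' s c := by ext i; fin_cases i <;> simp <;> ring
      invFun c := ![c 0, c 1 + c 2, c 1 - c 2]
      left_inv c := by ext i; fin_cases i <;> simp <;> ring
      right_inv c := by ext i; fin_cases i <;> simp }
  have hw : QuadraticMap.Equivalent Q
      (QuadraticMap.weightedSumSquares ℝ ![2 * r, 2 * r, -(2 * r)]) := by
    refine ⟨⟨(spEquiv h).trans e, fun f => ?_⟩⟩
    rw [hQ, trace_comp_eq h]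
    simp [QuadraticMap.weightedSumSquares_apply, Fin.sum_univ_three, e]
    ring
  have hp : {i | 0 < (![2 * r, 2 * r, -(2 * r)] : Fin 3 → ℝ) i} = ↑({0, 1} : Finset (Fin 3)) := by
    ext i; fin_cases i <;> simp [hr, hr.le]
  have hn : {i | (![2 * r, 2 * r, -(2 * r)] : Fin 3 → ℝ) i < 0} = ↑({2} : Finset (Fin 3)) := by
    ext i; fin_cases i <;> simp [hr, hr.le]
  rw [signature_congr hw, signature_weightedSumSquares, hp, hn, Set.ncard_coe_finset,
    Set.ncard_coe_finset]
  rfl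

end SymplecticPlane


/-! ### Nondegeneracy of the form on `T`, and traces -/

namespace SymplecticTripleSystem

variable {T : Type*} [AddCommGroup T] [Module ℝ T] {S : SymplecticTripleSystem ℝ T}

/-- The radical of the form is an ideal: it is stable under each `d_{x,y}` by skewness, and for `i`
in it `[x,y,i] - [x,i,y] = -(x|y) i`. It is not all of `T`, since the form is non-zero. -/
theorem IsSimple.eq_zero_of_form_eq_zero (hS : S.IsSimple) {x : T} (hx : ∀ y, S.form x y = 0) :
    x = 0 := by
  have hI : S.IsIdeal (LinearMap.ker S.form) := by
    have key : ∀ x y i : T, i ∈ LinearMap.ker S.form →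
        S.triple x y i ∈ LinearMap.ker S.form := by
      intro x y i hi
      rw [LinearMap.mem_ker] at hi ⊢
      ext z
      rw [S.form_triple, hi, LinearMap.zero_apply, neg_zero, LinearMap.zero_apply]
    intro x y i hi
    refine ⟨key x y i hi, ?_⟩
    have h1 := S.triple_sub x y i
    have h2 : ∀ z, S.form i z = 0 := fun z => by rw [LinearMap.mem_ker.1 hi]; rfl
    rw [S.form_swap x i, S.form_swap y i, h2, h2, neg_zero, mul_zero, zero_smul, zero_smul,
      zero_sub, add_zero] at h1
    rw [← sub_eq_iff_eq_add.2 (sub_eq_iff_eq_add'.1 h1), sub_neg_eq_add]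
    exact add_mem (key x y i hi) (Submodule.smul_mem _ _ hi)
  rcases hS.2 _ hI with h | h
  · rw [← Submodule.mem_bot ℝ, ← h, LinearMap.mem_ker]
    exact LinearMap.ext hx
  · exact absurd (LinearMap.ker_eq_top.1 h) S.form_ne_zero

theorem IsSimple.form_nondegenerate (hS : S.IsSimple) : S.form.Nondegenerate := by
  refine ⟨fun x hx => hS.eq_zero_of_form_eq_zero hx, fun x hx => ?_⟩
  refine hS.eq_zero_of_form_eq_zero fun y => ?_
  rw [S.form_swap, hx, neg_zero]

/-- The dual basis of a basis of `T` for the alternating form. -/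
def IsSimple.dualBasis (hS : S.IsSimple) {ι : Type*} [Finite ι] [DecidableEq ι]
    (e : Module.Basis ι ℝ T) : Module.Basis ι ℝ T :=
  LinearMap.BilinForm.dualBasis S.form hS.form_nondegenerate e

section Trace

variable (hS : S.IsSimple) {ι : Type*} [Fintype ι] [DecidableEq ι] (e : Module.Basis ι ℝ T)

theorem dualBasis_repr (x : T) (i : ι) : (hS.dualBasis e).repr x i = S.form x (e i) :=
  LinearMap.BilinForm.dualBasis_repr_apply hS.form_nondegenerate e x i

theorem form_dualBasis_left (x : T) (i : ι) : S.form (hS.dualBasis e i) x = e.repr x i := by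
  conv_lhs => rw [← e.sum_repr x]
  simp [IsSimple.dualBasis, LinearMap.BilinForm.apply_dualBasis_left, -Module.Basis.sum_repr]

theorem trace_eq_sum_form_dualBasis (f : Module.End ℝ T) :
    LinearMap.trace ℝ T f = ∑ i, S.form (hS.dualBasis e i) (f (e i)) := by
  rw [LinearMap.trace_eq_matrix_trace ℝ e]
  simp [Matrix.trace, LinearMap.toMatrix_apply, form_dualBasis_left]

include hS in
-- By skewness, the traces computed in a basis and in its dual basis are opposite.
theorem trace_inder [FiniteDimensional ℝ T] (f : S.inder) :
    LinearMap.trace ℝ T (f : Module.End ℝ T) = 0 := by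
  let e := Module.finBasis ℝ T
  have h := trace_eq_sum_form_dualBasis hS e (f : Module.End ℝ T)
  have h' : LinearMap.trace ℝ T (f : Module.End ℝ T)
      = -∑ i, S.form (hS.dualBasis e i) ((f : Module.End ℝ T) (e i)) := by
    rw [LinearMap.trace_eq_matrix_trace ℝ (hS.dualBasis e), ← Finset.sum_neg_distrib]
    simp only [Matrix.trace, LinearMap.toMatrix_apply, Matrix.diag_apply, dualBasis_repr]
    exact Finset.sum_congr rfl fun i _ => eq_neg_of_add_eq_zero_left (S.inder_form f _ _)
  linarith

include hS in
-- The identity for `[x,y,z] - [x,z,y]` writes `x ↦ [x,y,z]` as the traceless `d_{y,z}`, plus `(y|z)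
-- id`, plus two rank-one maps; these contribute `n`, `-1` and `2` times `(y|z)`.
theorem trace_triple [FiniteDimensional ℝ T] (y z : T) :
    LinearMap.trace ℝ T ((S.triple.flip y).flip z) = (Module.finrank ℝ T + 1) * S.form y z := by
  have e : (S.triple.flip y).flip z = S.triple y z + S.form y z • LinearMap.id
      - (S.form y).smulRight z + (2 : ℝ) • (S.form z).smulRight (-y) := by
    ext x
    have h := S.triple_sub y x z
    have h' := S.triple_comm x y z
    simp only [LinearMap.flip_apply, LinearMap.add_apply, LinearMap.sub_apply,
      LinearMap.smul_apply, LinearMap.id_apply, LinearMap.smulRight_apply]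
    rw [S.form_swap x z] at h
    linear_combination (norm := module) h + h'
  rw [e]
  simp only [map_add, map_sub, map_smul, LinearMap.trace_smulRight, LinearMap.trace_id]
  rw [show LinearMap.trace ℝ T (S.triple y z) = 0 from trace_inder hS (S.d y z)]
  simp only [map_neg, smul_eq_mul]
  rw [S.form_swap z y]
  ring

end Trace

/-! ### The bound `dim T ≤ dim 𝔥 + 1` -/

section Dimension

theorem triple_right_eq (x y : T) :
    S.triple x y x = S.triple x x y - (3 * S.form x y) • x := by
  have h := S.triple_sub x x y
  rw [S.form_isAlt.self_eq_zero] at h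
  linear_combination (norm := module) -h

/-- `d_{[x,x,x],x} = 0`. -/
theorem triple_cube_self (x : T) : S.triple (S.triple x x x) x = 0 := by
  have h := S.triple_lie x x x x
  rw [lie_self] at h
  have hc : S.triple x (S.triple x x x) = S.triple (S.triple x x x) x :=
    LinearMap.ext fun z => S.triple_comm _ _ z
  rw [hc, ← two_smul ℝ, eq_comm, smul_eq_zero] at h
  exact h.resolve_left two_ne_zero

/-- Expand the commutator of `d_{x,x}` and `d_{x,y}` as a derivation from either side and compare.
-/
theorem triple_polarized (x y : T) :
    S.triple (S.triple x x x) y + (3 : ℝ) • S.triple x (S.triple x x y)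
      - (6 * S.form x y) • S.triple x x = 0 := by
  have h1 := S.triple_lie x x x y
  have h2 := S.triple_lie x y x x
  have hc : S.triple (S.triple x x y) x = S.triple x (S.triple x x y) :=
    LinearMap.ext fun z => S.triple_comm _ _ z
  rw [triple_right_eq] at h2
  simp only [map_sub, map_smul, LinearMap.sub_apply, LinearMap.smul_apply, hc] at h2
  rw [← lie_skew, h2] at h1
  linear_combination (norm := module) -h1

/-- `triple_polarized` evaluated at `x`. It makes `d_{x,x}²` explicit up to rank-two terms, which
gives injectivity of `d_{x,x}` where the quartic form `(x|[x,x,x])` is non-zero. -/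
theorem triple_self_self_self (x y : T) :
    (3 : ℝ) • S.triple x x (S.triple x x y) = S.form x (S.triple x x x) • y
      - (8 * S.form (S.triple x x x) y) • x + (8 * S.form x y) • S.triple x x x := by
  have h1 := LinearMap.congr_fun (triple_polarized (S := S) x y) x
  have h2 := S.triple_sub (S.triple x x x) y x
  have h3 : S.triple (S.triple x x x) x y = 0 := by rw [triple_cube_self]; rfl
  have h4 := triple_right_eq (S := S) x (S.triple x x y)
  have h5 := S.form_triple x x x y
  rw [S.form_swap _ x, S.form_swap y x, h3] at h2
  simp only [LinearMap.add_apply, LinearMap.sub_apply, LinearMap.smul_apply,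
    LinearMap.zero_apply] at h1
  rw [h4, ← neg_eq_iff_eq_neg.2 h5] at h1
  linear_combination (norm := module) h1 - h2

/-- When the quartic form vanishes, polarisation determines the product: first `[x,x,x] = 0`, then
`[x,x,z]`, then `[x,y,z]`. -/
theorem triple_eq_of_quartic_eq_zero (hS : S.IsSimple)
    (hq : ∀ x, S.form x (S.triple x x x) = 0) (x y z : T) :
    S.triple x y z = S.form x z • y + S.form y z • x := by
  -- The part of the quartic form at `x + y` that is odd in `y`. Replacing `y` by `2y` below
  -- separates the degrees 1 and 3.
  have hA : ∀ x y, S.form (S.triple x x x) y + S.form (S.triple y y y) x = 0 := by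
    intro x y
    have h1 := hq (x + y)
    have h2 := hq (x - y)
    have e1 := S.form_triple x x x y
    have e2 := S.form_triple y y y x
    simp only [map_add, map_sub, LinearMap.add_apply, LinearMap.sub_apply,
      triple_right_eq x y, S.triple_comm y x, map_smul, smul_eq_mul, S.form_isAlt.self_eq_zero] at h1 h2
    rw [S.form_swap y (S.triple x x x), S.form_swap x (S.triple y y y)] at h1 h2
    rw [S.triple_comm x y y, triple_right_eq y x] at h1 h2
    simp only [map_sub, map_smul, smul_eq_mul, S.form_isAlt.self_eq_zero] at h1 h2
    linear_combination (-1 / 8 : ℝ) * (h1 - h2) + (3 / 4 : ℝ) * (e1 + e2)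
  have hc : ∀ x, S.triple x x x = 0 := by
    intro x
    refine hS.eq_zero_of_form_eq_zero fun y => ?_
    have h1 := hA x y
    have h2 := hA x ((2 : ℝ) • y)
    simp only [map_smul, LinearMap.smul_apply, smul_eq_mul] at h2
    linarith
  have hd : ∀ x, ∀ z, S.triple x x z = (2 * S.form x z) • x := by
    intro x z
    have h1 := hc (x + z)
    have h2 := hc (x - z)
    simp only [map_add, map_sub, LinearMap.add_apply, LinearMap.sub_apply, hc,
      S.triple_comm z x, triple_right_eq x z] at h1 h2
    have h3 : (6 : ℝ) • S.triple x x z = (6 : ℝ) • ((2 * S.form x z) • x) := by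
      linear_combination (norm := module) h1 - h2
    exact smul_right_injective T (by norm_num : (6 : ℝ) ≠ 0) h3
  have h := hd (x + y) z
  simp only [map_add, LinearMap.add_apply, hd, S.triple_comm y x] at h
  have h2 : (2 : ℝ) • S.triple x y z = (2 : ℝ) • (S.form x z • y + S.form y z • x) := by
    linear_combination (norm := module) h
  exact smul_right_injective T two_ne_zero h2

theorem finrank_le_finrank_inder_add_one [FiniteDimensional ℝ T] (hS : S.IsSimple) :
    Module.finrank ℝ T ≤ Module.finrank ℝ S.inder + 1 := by
  obtain ⟨x, v, hx⟩ : ∃ x v : T, LinearMap.ker (S.d x) ≤ Submodule.span ℝ {v} := by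
    by_cases hq : ∀ x, S.form x (S.triple x x x) = 0
    · have ht := triple_eq_of_quartic_eq_zero hS hq
      obtain ⟨u, w, huw⟩ : ∃ u w : T, S.form u w ≠ 0 := by
        by_contra! h
        exact S.form_ne_zero (LinearMap.ext₂ h)
      refine ⟨u, u, fun y hy => ?_⟩
      have h : S.triple u y w = 0 := by
        rw [← S.d_apply, LinearMap.mem_ker.1 hy]; rfl
      rw [ht] at h
      rw [Submodule.mem_span_singleton]
      refine ⟨-((S.form u w)⁻¹ * S.form y w), ?_⟩
      have h' : (S.form u w)⁻¹ • (S.form u w • y + S.form y w • u) = 0 := by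
        rw [h, smul_zero]
      rw [smul_add, inv_smul_smul₀ huw] at h'
      linear_combination (norm := module) -h'
    · push Not at hq
      obtain ⟨x, hq⟩ := hq
      -- If `[x,x,y] = 0`, then `([x,x,x]|y) = 0` by skewness; pairing `triple_self_self_self` with
      -- `x` gives `(x|y) = 0`, and what remains of it is a non-zero multiple of `y`.
      have hinj : Function.Injective (S.triple x x) := by
        rw [injective_iff_map_eq_zero]
        intro y hy
        have h1 := triple_self_self_self (S := S) x y
        have h2 := S.form_triple x x x y
        rw [hy, map_zero, smul_zero] at h1
        rw [hy, map_zero, neg_zero] at h2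
        have h3 : S.form x (S.triple x x x) * S.form x y = 0 := by
          have := congrArg (S.form x) h1
          simp only [map_add, map_sub, map_smul, smul_eq_mul, map_zero, h2,
            S.form_isAlt.self_eq_zero] at this
          linear_combination (-1 / 9 : ℝ) * this
        have h4 := (mul_eq_zero.1 h3).resolve_left hq
        rw [h2, h4] at h1
        have h5 : S.form x (S.triple x x x) • y = 0 := by
          linear_combination (norm := module) -h1
        exact (smul_eq_zero.1 h5).resolve_left hq
      -- If `d_{x,y} = 0`, then `[x,y,x] = 0` reads `[x,x,y] = 3(x|y) x`, so `y` is a multiple of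
      -- the preimage `v` of `x` under `d_{x,x}`.
      obtain ⟨v, hv⟩ := (LinearMap.injective_iff_surjective.1 hinj) x
      refine ⟨x, v, fun y hy => ?_⟩
      have h : S.triple x y x = 0 := by
        rw [← S.d_apply, LinearMap.mem_ker.1 hy]; rfl
      rw [triple_right_eq, sub_eq_zero] at h
      rw [Submodule.mem_span_singleton]
      refine ⟨3 * S.form x y, hinj ?_⟩
      rw [map_smul, hv, h]
  have h1 := (S.d x).finrank_range_add_finrank_ker
  have h2 := Submodule.finrank_mono hx
  have h3 := finrank_span_le_card (R := ℝ) ({v} : Set T)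
  rw [Set.toFinset_singleton, Finset.card_singleton] at h3
  have h4 := Submodule.finrank_le (LinearMap.range (S.d x))
  omega

theorem one_lt_finrank_inder [FiniteDimensional ℝ T] (hh : LieAlgebra.IsSimple ℝ S.inder) :
    1 < Module.finrank ℝ S.inder := by
  by_contra! h
  obtain ⟨v, hv⟩ := finrank_le_one_iff.1 h
  refine hh.non_abelian ⟨fun x y => ?_⟩
  obtain ⟨r, rfl⟩ := hv x
  obtain ⟨s, rfl⟩ := hv y
  rw [smul_lie, lie_smul, lie_self, smul_zero, smul_zero]

/-- For `n ≥ 3` use `dim 𝔥 ≥ n - 1` and `(n + 4)(n - 1) - n(n + 1) = 2n - 4 > 0`; for smaller `n`,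
`dim 𝔥 ≥ 2` suffices. -/
theorem finrank_mul_lt [FiniteDimensional ℝ T] (hS : S.IsSimple)
    (hh : LieAlgebra.IsSimple ℝ S.inder) :
    Module.finrank ℝ T * (Module.finrank ℝ T + 1)
      < (Module.finrank ℝ T + 4) * Module.finrank ℝ S.inder := by
  have h1 := finrank_le_finrank_inder_add_one hS
  have h2 := one_lt_finrank_inder hh
  generalize Module.finrank ℝ T = n at *
  generalize Module.finrank ℝ S.inder = m at *
  rcases Nat.lt_or_ge n 3 with h | h
  · interval_cases n <;> omega
  · nlinarith

end Dimension
end SymplecticTripleSystem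


/-! ### The Killing form of the enveloping algebra -/

namespace SymplecticTripleSystem

variable {T V : Type*} [AddCommGroup T] [Module ℝ T] [AddCommGroup V] [Module ℝ V]
  (S : SymplecticTripleSystem ℝ T) (P : SymplecticPlane ℝ V)

namespace EnvelopingAlgebra

/-- The splitting of the enveloping algebra into its even and odd parts. -/
def prodEquiv : S.EnvelopingAlgebra P ≃ₗ[ℝ] (P.sp × S.inder) × (V ⊗[ℝ] T) where
  toFun x := (even x, odd x)
  map_add' _ _ := rfl
  map_smul' _ _ := rfl
  invFun x := x
  left_inv _ := rfl
  right_inv _ := rfl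

/-- The inclusion of the even part. -/
def ofEven : (P.sp × S.inder) →ₗ[ℝ] S.EnvelopingAlgebra P :=
  (prodEquiv S P).symm.toLinearMap ∘ₗ LinearMap.inl ℝ _ _

/-- The inclusion of the odd part. -/
def ofOdd : (V ⊗[ℝ] T) →ₗ[ℝ] S.EnvelopingAlgebra P :=
  (prodEquiv S P).symm.toLinearMap ∘ₗ LinearMap.inr ℝ _ _

variable {S P}

theorem even_ofEven (e : P.sp × S.inder) : even (ofEven S P e) = e := rfl

theorem odd_ofEven (e : P.sp × S.inder) : odd (ofEven S P e) = 0 := rfl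

theorem even_ofOdd (u : V ⊗[ℝ] T) : even (ofOdd S P u) = 0 := rfl

theorem odd_ofOdd (u : V ⊗[ℝ] T) : odd (ofOdd S P u) = u := rfl

theorem lie_ofEven_ofOdd (e : P.sp × S.inder) (u : V ⊗[ℝ] T) :
    ⁅ofEven S P e, ofOdd S P u⁆ = ofOdd S P (S.act P e u) := by
  apply ext
  · rw [even_lie, even_ofEven, even_ofOdd, odd_ofEven, lie_zero, map_zero,
      LinearMap.zero_apply, add_zero, even_ofOdd]
  · rw [odd_lie, even_ofEven, even_ofOdd, odd_ofEven, odd_ofOdd, odd_ofOdd, map_zero,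
      sub_zero]

theorem lie_ofOdd_ofOdd (u v : V ⊗[ℝ] T) :
    ⁅ofOdd S P u, ofOdd S P v⁆ = ofEven S P (S.oddMul P u v) := by
  apply ext
  · rw [even_lie, even_ofOdd, even_ofOdd, odd_ofOdd, odd_ofOdd, lie_zero, zero_add, even_ofEven]
  · rw [odd_lie, even_ofOdd, even_ofOdd, map_zero, LinearMap.zero_apply, LinearMap.zero_apply,
      sub_zero, odd_ofEven]

variable (S P) in
/-- The automorphism that changes the sign of the odd part. -/
def parity : S.EnvelopingAlgebra P ≃ₗ⁅ℝ⁆ S.EnvelopingAlgebra P where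
  toFun x := ofEven S P (even x) - ofOdd S P (odd x)
  map_add' x y := by simp only [map_add]; abel
  map_smul' r x := by simp only [map_smul, smul_sub, RingHom.id_apply]
  map_lie' := by
    intro x y
    apply ext
    · simp [even_lie, even_ofEven, even_ofOdd, odd_ofEven, odd_ofOdd]
    · simp [odd_lie, even_ofEven, even_ofOdd, odd_ofEven, odd_ofOdd]
  invFun x := ofEven S P (even x) - ofOdd S P (odd x)
  left_inv x := by
    apply ext <;> simp [even_ofEven, even_ofOdd, odd_ofEven, odd_ofOdd]
  right_inv x := by
    apply ext <;> simp [even_ofEven, even_ofOdd, odd_ofEven, odd_ofOdd]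

/-- The Killing form is invariant under `parity`, which would change the sign of this value. -/
theorem killingForm_even_odd (e : P.sp × S.inder) (u : V ⊗[ℝ] T) :
    killingForm ℝ (S.EnvelopingAlgebra P) (ofEven S P e) (ofOdd S P u) = 0 := by
  have h := LieAlgebra.killingForm_of_equiv_apply (parity S P) (ofEven S P e) (ofOdd S P u)
  have h1 : parity S P (ofEven S P e) = ofEven S P e := by
    change ofEven S P e - ofOdd S P 0 = _
    rw [map_zero, sub_zero]
  have h2 : parity S P (ofOdd S P u) = -ofOdd S P u := by
    change ofEven S P 0 - ofOdd S P u = _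
    rw [map_zero, zero_sub]
  rw [h1, h2, map_neg] at h
  linarith

theorem ad_ofEven (e : P.sp × S.inder) :
    (prodEquiv S P).conj (LieAlgebra.ad ℝ (S.EnvelopingAlgebra P) (ofEven S P e))
      = ((LieAlgebra.ad ℝ P.sp e.1).prodMap (LieAlgebra.ad ℝ S.inder e.2)).prodMap
        (S.act P e) := by
  refine LinearMap.ext fun z => ?_
  have h : ∀ z, even ((prodEquiv S P).symm z) = z.1 := fun _ => rfl
  have h' : ∀ z, odd ((prodEquiv S P).symm z) = z.2 := fun _ => rfl
  refine Prod.ext ?_ ?_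
  · change even ⁅ofEven S P e, (prodEquiv S P).symm z⁆ = (⁅e.1, z.1.1⁆, ⁅e.2, z.1.2⁆)
    rw [even_lie, odd_ofEven, map_zero, LinearMap.zero_apply, add_zero]
    rfl
  · change odd ⁅ofEven S P e, (prodEquiv S P).symm z⁆ = S.act P e z.2
    rw [odd_lie, odd_ofEven, map_zero, sub_zero]
    rfl

variable (S) in
/-- The restriction to `inder(T)` of the Killing form of the enveloping algebra. -/
def inderForm : LinearMap.BilinForm ℝ S.inder :=
  killingForm ℝ S.inder + (2 : ℝ) • LieModule.traceForm ℝ S.inder T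

theorem inderForm_apply (f g : S.inder) : inderForm S f g = killingForm ℝ S.inder f g
    + 2 * LinearMap.trace ℝ T ((f : Module.End ℝ T) ∘ₗ (g : Module.End ℝ T)) := rfl

theorem inderForm_lie (f g k : S.inder) : inderForm S ⁅f, g⁆ k = inderForm S f ⁅g, k⁆ := by
  have h1 : killingForm ℝ S.inder ⁅f, g⁆ k = killingForm ℝ S.inder f ⁅g, k⁆ :=
    LieModule.traceForm_apply_lie_apply ..
  have h2 := LieModule.traceForm_apply_lie_apply ℝ S.inder T f g k
  simp only [inderForm, LinearMap.add_apply, LinearMap.smul_apply, h1, h2]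

variable [FiniteDimensional ℝ T] [FiniteDimensional ℝ V]

/-- The mixed terms are traces of tensor products with a traceless factor from `𝔥`; the factor 2 is
`dim V`. -/
theorem trace_act_comp_act (hS : S.IsSimple) (e e' : P.sp × S.inder) :
    LinearMap.trace ℝ (V ⊗[ℝ] T) (S.act P e ∘ₗ S.act P e')
      = Module.finrank ℝ T
          * LinearMap.trace ℝ V ((e.1 : Module.End ℝ V) ∘ₗ (e'.1 : Module.End ℝ V))
        + 2 * LinearMap.trace ℝ T ((e.2 : Module.End ℝ T) ∘ₗ (e'.2 : Module.End ℝ T)) := by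
  have h : S.act P e ∘ₗ S.act P e'
      = TensorProduct.map ((e.1 : Module.End ℝ V) ∘ₗ (e'.1 : Module.End ℝ V)) LinearMap.id
        + TensorProduct.map (e.1 : Module.End ℝ V) (e'.2 : Module.End ℝ T)
        + TensorProduct.map (e'.1 : Module.End ℝ V) (e.2 : Module.End ℝ T)
        + TensorProduct.map LinearMap.id
          ((e.2 : Module.End ℝ T) ∘ₗ (e'.2 : Module.End ℝ T)) := by
    refine TensorProduct.ext' fun a x => ?_
    simp only [LinearMap.comp_apply, LinearMap.add_apply, act_tmul, map_add,
      TensorProduct.map_tmul, LinearMap.id_apply]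
    abel
  rw [h]
  simp only [map_add, LinearMap.trace_tensorProduct', trace_inder hS, LinearMap.trace_id]
  have : Module.finrank ℝ V = 2 := P.finrank_eq_two
  rw [this]
  push_cast
  ring

/-- In `n + 4`, the 4 comes from the adjoint action on `𝔰𝔭(V)` and the `n` from the action on `V ⊗
T`. -/
theorem killingForm_even (hS : S.IsSimple) (e e' : P.sp × S.inder) :
    killingForm ℝ (S.EnvelopingAlgebra P) (ofEven S P e) (ofEven S P e')
      = (Module.finrank ℝ T + 4)
          * LinearMap.trace ℝ V ((e.1 : Module.End ℝ V) ∘ₗ (e'.1 : Module.End ℝ V))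
        + (killingForm ℝ S.inder e.2 e'.2
          + 2 * LinearMap.trace ℝ T ((e.2 : Module.End ℝ T) ∘ₗ (e'.2 : Module.End ℝ T))) := by
  have h1 := P.killingForm_sp e.1 e'.1
  rw [killingForm_apply_apply] at h1 ⊢
  rw [← LinearMap.trace_conj' _ (prodEquiv S P), LinearEquiv.conj_comp, ad_ofEven, ad_ofEven,
    LinearMap.prodMap_comp, LinearMap.prodMap_comp, LinearMap.trace_prodMap',
    LinearMap.trace_prodMap', trace_act_comp_act hS, h1, killingForm_apply_apply]
  ring

theorem killingForm_odd_tmul (hS : S.IsSimple) (a b : V) (x y : T) :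
    killingForm ℝ (S.EnvelopingAlgebra P) (ofOdd S P (a ⊗ₜ x)) (ofOdd S P (b ⊗ₜ y))
      = -(2 * (Module.finrank ℝ T + 4)) * (P.form a b * S.form x y) := by
  by_cases ha : a = 0
  · simp [ha]
  obtain ⟨c, hc⟩ := P.exists_form_ne_zero ha
  -- Since `γ_{a,a}(c) = 2⟨a|c⟩ a`, this scaling sends `c` to `a`. Then `a ⊗ x = [γ, c ⊗ x]`, and
  -- invariance moves the computation to the even part.
  let γ : P.sp := (2 * P.form a c)⁻¹ • P.gamma a a
  have hγ : (γ : Module.End ℝ V) c = a := by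
    have h2 : (2 * P.form a c)⁻¹ * (2 * P.form a c) = 1 :=
      inv_mul_cancel₀ (mul_ne_zero two_ne_zero hc)
    change (2 * P.form a c)⁻¹ • (P.form a c • a + P.form a c • a) = a
    rw [← two_smul ℝ (P.form a c • a), smul_smul, smul_smul, mul_assoc, h2, one_smul]
  have h : ofOdd S P (a ⊗ₜ x) = ⁅ofEven S P (γ, 0), ofOdd S P (c ⊗ₜ x)⁆ := by
    rw [lie_ofEven_ofOdd, act_tmul]
    change _ = ofOdd S P ((γ : Module.End ℝ V) c ⊗ₜ[ℝ] x + c ⊗ₜ[ℝ] (0 : T))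
    rw [hγ, TensorProduct.tmul_zero, add_zero]
  rw [h]
  change LieModule.traceForm _ _ _ _ _ = _
  rw [LieModule.traceForm_apply_lie_apply]
  change killingForm _ _ _ _ = _
  rw [lie_ofOdd_ofOdd, killingForm_even hS, oddMul_tmul, LinearMap.trace_comp_comm']
  have h1 := P.trace_gamma_comp c b γ
  rw [SymplecticPlane.form_apply_right, hγ] at h1
  simp only [coe_smul_End, LinearMap.smul_comp, map_smul, h1, map_zero, LinearMap.zero_apply,
    ZeroMemClass.coe_zero, LinearMap.zero_comp, smul_eq_mul]
  ring

/-- Invariance of the Killing form of `𝔤(T)` on `f`, `a ⊗ x`, `b ⊗ y` with `⟨a|b⟩ = 1`. This formula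
drives both nondegeneracy and the Casimir computation. -/
theorem inderForm_d (P : SymplecticPlane ℝ V) (hS : S.IsSimple) (f : S.inder) (x y : T) :
    inderForm S f (S.d x y)
      = 2 * (Module.finrank ℝ T + 4) * S.form x ((f : Module.End ℝ T) y) := by
  obtain ⟨a, b, h⟩ := P.exists_form_eq_one
  have h1 : killingForm ℝ (S.EnvelopingAlgebra P) ⁅ofEven S P (0, f), ofOdd S P (a ⊗ₜ x)⁆
        (ofOdd S P (b ⊗ₜ y))
      = killingForm ℝ (S.EnvelopingAlgebra P) (ofEven S P (0, f))
        ⁅ofOdd S P (a ⊗ₜ x), ofOdd S P (b ⊗ₜ y)⁆ :=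
    LieModule.traceForm_apply_lie_apply ..
  rw [lie_ofEven_ofOdd, act_tmul, lie_ofOdd_ofOdd, killingForm_even hS, oddMul_tmul, h] at h1
  simp only [ZeroMemClass.coe_zero, LinearMap.zero_apply, TensorProduct.zero_tmul, zero_add,
    LinearMap.zero_comp, map_zero, mul_zero, one_smul, killingForm_odd_tmul hS, h, one_mul] at h1
  rw [inderForm_apply, ← h1, eq_neg_of_add_eq_zero_left (S.inder_form f x y)]
  ring

theorem signature_killingForm_odd (hS : S.IsSimple) :
    signature ((LinearMap.BilinMap.toQuadraticMap
      (killingForm ℝ (S.EnvelopingAlgebra P))).comp (ofOdd S P)) = 0 := by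
  obtain ⟨φ, hφ⟩ := P.exists_form_neg
  let Φ : V ⊗[ℝ] T ≃ₗ[ℝ] V ⊗[ℝ] T := TensorProduct.congr φ (LinearEquiv.refl ℝ T)
  have key : ∀ u v, killingForm ℝ (S.EnvelopingAlgebra P) (ofOdd S P (Φ u)) (ofOdd S P (Φ v))
      = -killingForm ℝ (S.EnvelopingAlgebra P) (ofOdd S P u) (ofOdd S P v) := by
    intro u v
    induction u with
    | zero => simp
    | add u u' h h' => simp only [map_add, LinearMap.add_apply, h, h', neg_add]
    | tmul a x =>
      induction v with
      | zero => simp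
      | add v v' h h' => simp only [map_add, h, h', neg_add]
      | tmul b y =>
        simp only [Φ, TensorProduct.congr_tmul, LinearEquiv.refl_apply, killingForm_odd_tmul hS,
          hφ]
        ring
  refine signature_eq_zero_of_equivalent_neg ⟨⟨Φ, fun u => ?_⟩⟩
  change -killingForm ℝ (S.EnvelopingAlgebra P) (ofOdd S P (Φ u)) (ofOdd S P (Φ u))
    = killingForm ℝ (S.EnvelopingAlgebra P) (ofOdd S P u) (ofOdd S P u)
  rw [key, neg_neg]

theorem killingSignature_eq (hS : S.IsSimple) : killingSignature (S.EnvelopingAlgebra P)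
    = 1 + signature (LinearMap.BilinMap.toQuadraticMap (inderForm S)) := by
  let Q := LinearMap.BilinMap.toQuadraticMap (killingForm ℝ (S.EnvelopingAlgebra P))
  let Qs : QuadraticForm ℝ P.sp := Q.comp (ofEven S P ∘ₗ LinearMap.inl ℝ _ _)
  have hs : ∀ f : P.sp, Qs f = (Module.finrank ℝ T + 4)
      * LinearMap.trace ℝ V ((f : Module.End ℝ V) ∘ₗ (f : Module.End ℝ V)) := by
    intro f
    change killingForm ℝ (S.EnvelopingAlgebra P) (ofEven S P (f, 0)) (ofEven S P (f, 0)) = _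
    simp [killingForm_even hS]
  have e : QuadraticMap.Equivalent Q ((Qs.prod
      (LinearMap.BilinMap.toQuadraticMap (inderForm S))).prod (Q.comp (ofOdd S P))) := by
    refine ⟨⟨prodEquiv S P, fun z => ?_⟩⟩
    have hz : z = ofEven S P (even z) + ofOdd S P (odd z) := by
      apply ext <;> simp [even_ofEven, even_ofOdd, odd_ofEven, odd_ofOdd]
    change Qs (even z).1 + inderForm S (even z).2 (even z).2
      + killingForm ℝ (S.EnvelopingAlgebra P) (ofOdd S P (odd z)) (ofOdd S P (odd z))
      = killingForm ℝ (S.EnvelopingAlgebra P) z z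
    conv_rhs => rw [hz]
    have h' : killingForm ℝ (S.EnvelopingAlgebra P) (ofOdd S P (odd z)) (ofEven S P (even z))
        = 0 := by
      rw [← killingForm_even_odd (even z) (odd z)]
      exact LieModule.traceForm_comm ..
    rw [hs, inderForm_apply, map_add, map_add, LinearMap.add_apply, LinearMap.add_apply, h',
      killingForm_even_odd, killingForm_even hS]
    ring
  have : FiniteDimensional ℝ S.inder := inferInstance
  change signature Q = _
  rw [signature_congr e, signature_prod, signature_prod, signature_killingForm_odd hS,
    P.signature_trace_sp (by positivity) hs, add_zero]

end EnvelopingAlgebra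
end SymplecticTripleSystem


/-! ### Invariant forms on a real simple Lie algebra -/

section InvariantForms

variable {L : Type*} [LieRing L] [LieAlgebra ℝ L]

/-- Schur's lemma for the adjoint representation of a simple Lie algebra. -/
theorem LieAlgebra.IsSimple.eq_zero_of_lie_comm (hL : LieAlgebra.IsSimple ℝ L)
    {N : Module.End ℝ L} (hN : ∀ x y : L, N ⁅x, y⁆ = ⁅x, N y⁆) (hk : ¬ Function.Injective N) :
    N = 0 := by
  let I : LieIdeal ℝ L :=
    { LinearMap.ker N with
      lie_mem := by
        intro x y hy
        change N ⁅x, y⁆ = 0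
        have hy : N y = 0 := hy
        rw [hN, hy, lie_zero] }
  rcases hL.eq_bot_or_eq_top I with h | h
  · refine absurd (LinearMap.ker_eq_bot.1 ?_) hk
    rw [Submodule.eq_bot_iff]
    intro x hx
    have : x ∈ I := hx
    rwa [h, LieSubmodule.mem_bot] at this
  · ext x
    have : x ∈ I := h ▸ LieSubmodule.mem_top x
    exact this

theorem Module.End.aeval_lie_comm {J : Module.End ℝ L} (hJ : ∀ x y : L, J ⁅x, y⁆ = ⁅x, J y⁆)
    (p : Polynomial ℝ) (x y : L) :
    Polynomial.aeval J p ⁅x, y⁆ = ⁅x, Polynomial.aeval J p y⁆ := by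
  induction p using Polynomial.induction_on' with
  | add p q hp hq => simp only [map_add, LinearMap.add_apply, hp, hq, lie_add]
  | monomial n r =>
    simp only [Polynomial.aeval_monomial, Module.End.mul_apply, Module.algebraMap_end_apply,
      lie_smul]
    congr 1
    induction n generalizing y with
    | zero => rfl
    | succ n ih => rw [pow_succ, Module.End.mul_apply, Module.End.mul_apply, hJ, ih]

/-- The real centroid of a simple Lie algebra consists of roots of quadratic polynomials:
an endomorphism that commutes with the adjoint action is a scalar, or differs by a scalar
from one with negative square. -/
theorem LieAlgebra.IsSimple.exists_sq_eq [FiniteDimensional ℝ L] (hL : LieAlgebra.IsSimple ℝ L)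
    {J : Module.End ℝ L} (hJ : ∀ x y : L, J ⁅x, y⁆ = ⁅x, J y⁆) :
    (∃ r : ℝ, ∀ x, J x = r • x) ∨
      ∃ s t : ℝ, t < 0 ∧ ∀ x, J (J x - s • x) - s • (J x - s • x) = t • x := by
  obtain ⟨p, hp, hpJ⟩ : ∃ p : Polynomial ℝ, Irreducible p ∧ Polynomial.aeval J p = 0 := by
    have : Nontrivial L := by
      by_contra h
      rw [not_nontrivial_iff_subsingleton] at h
      exact hL.non_abelian ⟨fun x y => Subsingleton.elim _ _⟩
    have hint : IsIntegral ℝ J := Algebra.IsIntegral.isIntegral J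
    -- For an irreducible factor `p` of the minimal polynomial, `p(J)` cannot be injective, as the
    -- cofactor `q` would then annihilate `J`. By Schur's lemma `p(J) = 0`, and real irreducibles
    -- have degree at most two.
    obtain ⟨p, hp, q, hq⟩ := WfDvdMonoid.exists_irreducible_factor
      (minpoly.not_isUnit ℝ J) (minpoly.ne_zero hint)
    refine ⟨p, hp, hL.eq_zero_of_lie_comm (Module.End.aeval_lie_comm hJ p) fun hinj => ?_⟩
    have h0 : Polynomial.aeval J p * Polynomial.aeval J q = 0 := by
      rw [← map_mul, ← hq, minpoly.aeval]
    have hqJ : Polynomial.aeval J q = 0 := by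
      ext x
      apply hinj
      rw [LinearMap.zero_apply, map_zero, ← Module.End.mul_apply, h0, LinearMap.zero_apply]
    have hdvd : p * q ∣ q := hq ▸ minpoly.dvd ℝ J hqJ
    have hq0 : q ≠ 0 := by
      rintro rfl
      exact minpoly.ne_zero hint (by rw [hq, mul_zero])
    exact hp.not_isUnit (isUnit_of_dvd_one ((mul_dvd_mul_iff_right hq0).1 (by rwa [one_mul])))
  have hdeg := Polynomial.eq_quadratic_of_degree_le_two hp.degree_le_two
  set a := p.coeff 2
  set b := p.coeff 1
  set c := p.coeff 0
  have hx : ∀ x, a • J (J x) + b • J x + c • x = 0 := by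
    intro x
    have := LinearMap.congr_fun hpJ x
    rw [hdeg] at this
    simpa [pow_two] using this
  by_cases ha : a = 0
  · left
    have hb : b ≠ 0 := by
      intro hb
      rw [ha, hb, map_zero, zero_mul, zero_mul, zero_add, zero_add] at hdeg
      have h1 := hp.natDegree_pos
      rw [hdeg, Polynomial.natDegree_C] at h1
      exact lt_irrefl _ h1
    refine ⟨-(b⁻¹ * c), fun x => ?_⟩
    have h := congrArg (b⁻¹ • ·) (hx x)
    simp only [ha, zero_smul, zero_add, smul_add, inv_smul_smul₀ hb, smul_zero] at h
    linear_combination (norm := module) h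
  -- Completing the square: `(J - s)² = t` with `s = -b/(2a)` and `t` the discriminant over `4a²`.
  · have hsq : ∀ x, J (J x - (-(b / (2 * a))) • x) - (-(b / (2 * a))) • (J x - (-(b / (2 * a))) • x)
        = ((b ^ 2 - 4 * a * c) / (4 * a ^ 2)) • x := by
      intro x
      have h := congrArg (a⁻¹ • ·) (hx x)
      simp only [smul_add, inv_smul_smul₀ ha, smul_zero, smul_smul] at h
      rw [map_sub, map_smul]
      have e1 : b / (2 * a) = a⁻¹ * b / 2 := by field_simp
      have e2 : (b ^ 2 - 4 * a * c) / (4 * a ^ 2) = (a⁻¹ * b) ^ 2 / 4 - a⁻¹ * c := by field_simp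
      rw [e1, e2]
      linear_combination (norm := module) h
    generalize -(b / (2 * a)) = s at hsq
    generalize (b ^ 2 - 4 * a * c) / (4 * a ^ 2) = t at hsq
    rcases lt_or_ge t 0 with ht | ht
    · exact Or.inr ⟨s, t, ht, hsq⟩
    · left
      have hr := Real.mul_self_sqrt ht
      generalize √t = r at hr
      -- With `t = r²`, the product `(J - s - r)(J - s + r)` is zero. Either the first factor is
      -- injective and the second vanishes, or the first vanishes by Schur's lemma.
      let N : Module.End ℝ L := J - (s + r) • LinearMap.id
      have hN : ∀ x, N x = J x - (s + r) • x := fun x => rfl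
      by_cases hinj : Function.Injective N
      · refine ⟨s - r, fun x => ?_⟩
        rw [← sub_eq_zero]
        apply hinj
        have h := hsq x
        rw [← hr, map_sub, map_smul] at h
        rw [map_zero, hN, map_sub, map_smul]
        linear_combination (norm := module) h
      · refine ⟨s + r, fun x => ?_⟩
        have hN0 := hL.eq_zero_of_lie_comm (N := N) (fun x y => by
          rw [hN, hN, hJ, lie_sub, lie_smul]) hinj
        rw [← sub_eq_zero, ← hN, hN0, LinearMap.zero_apply]

/-- Two invariant symmetric bilinear forms on a real simple Lie algebra, the first one
nondegenerate, are proportional or both of signature zero. -/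
theorem LieAlgebra.IsSimple.eq_smul_or_signature_eq_zero [FiniteDimensional ℝ L]
    (hL : LieAlgebra.IsSimple ℝ L) {K B : LinearMap.BilinForm ℝ L} (hK : K.Nondegenerate)
    (hKs : ∀ x y, K x y = K y x) (hBs : ∀ x y, B x y = B y x)
    (hKi : ∀ x y z, K ⁅x, y⁆ z = K x ⁅y, z⁆) (hBi : ∀ x y z, B ⁅x, y⁆ z = B x ⁅y, z⁆) :
    (∃ r : ℝ, B = r • K) ∨ (signature (LinearMap.BilinMap.toQuadraticMap K) = 0 ∧
      signature (LinearMap.BilinMap.toQuadraticMap B) = 0) := by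
  -- `J` represents `B` through `K`: invariance of both forms makes it commute with the adjoint
  -- action, and their symmetry makes it `K`-symmetric.
  let J : Module.End ℝ L := (LinearMap.BilinForm.toDual K hK).symm.toLinearMap ∘ₗ B
  have hKJ : ∀ x y, K (J x) y = B x y := fun x y =>
    LinearMap.BilinForm.apply_toDual_symm_apply (hB := hK) (B x) y
  have hext : ∀ x x', (∀ y, K x y = K x' y) → x = x' := by
    intro x x' h
    rw [← sub_eq_zero]
    refine hK.1 _ fun y => ?_
    rw [map_sub, LinearMap.sub_apply, h, sub_self]
  have hJ : ∀ x y : L, J ⁅x, y⁆ = ⁅x, J y⁆ := by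
    intro x y
    refine hext _ _ fun z => ?_
    rw [hKJ, ← lie_skew, map_neg, LinearMap.neg_apply, hBi, ← hKJ, ← hKi, ← lie_skew, map_neg,
      LinearMap.neg_apply, neg_neg]
  have hJs : ∀ x y, K (J x) y = K x (J y) := by
    intro x y
    rw [hKJ, hBs, ← hKJ, hKs]
  rcases hL.exists_sq_eq hJ with ⟨r, hr⟩ | ⟨s, t, ht, h⟩
  · left
    refine ⟨r, ?_⟩
    ext x y
    rw [← hKJ, hr, map_smul]
    rfl
  · right
    -- Normalised so that `N² = -1`. Being `K`-symmetric, `N` carries `K` to `-K`; commuting with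
    -- `J`, it carries `B` to `-B`.
    let N : Module.End ℝ L := (√(-t))⁻¹ • (J - s • LinearMap.id)
    have hN : ∀ x, N x = (√(-t))⁻¹ • (J x - s • x) := fun x => rfl
    have hr : (√(-t))⁻¹ * (√(-t))⁻¹ * t = -1 := by
      rw [← mul_inv, Real.mul_self_sqrt (by linarith), inv_neg, neg_mul, inv_mul_cancel₀ ht.ne]
    have hNN : ∀ x, N (N x) = -x := by
      intro x
      rw [hN, hN, map_smul, smul_comm s, ← smul_sub, h, smul_smul, smul_smul, hr, neg_one_smul]
    have hNs : ∀ x y, K (N x) y = K x (N y) := by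
      intro x y
      simp only [hN, map_smul, map_sub, LinearMap.smul_apply, LinearMap.sub_apply, hJs]
    have hNJ : ∀ x, J (N x) = N (J x) := by
      intro x
      simp only [hN, map_smul, map_sub]
    have hKN : ∀ x y, K (N x) (N y) = - K x y := by
      intro x y
      rw [hNs, hNN, map_neg]
    let e : L ≃ₗ[ℝ] L := LinearEquiv.ofLinearMap N (-N)
      (by ext x; simp [hNN]) (by ext x; simp [hNN])
    constructor
    · refine signature_eq_zero_of_equivalent_neg ⟨⟨e, fun x => ?_⟩⟩
      change -K (N x) (N x) = K x x
      rw [hKN, neg_neg]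
    · refine signature_eq_zero_of_equivalent_neg ⟨⟨e, fun x => ?_⟩⟩
      change -B (N x) (N x) = B x x
      rw [← hKJ, hNJ, hKN, neg_neg, hKJ]

end InvariantForms

/-! ### Comparison of `inderForm` with the Killing form of `𝔥` -/

namespace SymplecticTripleSystem

open EnvelopingAlgebra

variable {T V : Type*} [AddCommGroup T] [Module ℝ T] [FiniteDimensional ℝ T]
  [AddCommGroup V] [Module ℝ V] [FiniteDimensional ℝ V] {S : SymplecticTripleSystem ℝ T}

theorem inderForm_comm (f g : S.inder) : inderForm S f g = inderForm S g f := by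
  rw [inderForm_apply, inderForm_apply, LinearMap.trace_comp_comm']
  congr 1
  exact LieModule.traceForm_comm ..

/-- By `inderForm_d`, an `f` in the radical satisfies `(x|f(y)) = 0` for all `x` and `y`, so `f =
0`. -/
theorem inderForm_nondegenerate (P : SymplecticPlane ℝ V) (hS : S.IsSimple) :
    (inderForm S).Nondegenerate := by
  have h : ∀ f, (∀ g, inderForm S f g = 0) → f = 0 := by
    intro f hf
    ext y
    refine hS.eq_zero_of_form_eq_zero fun x => ?_
    have h1 := inderForm_d P hS f x y
    rw [hf, eq_comm] at h1
    rw [S.form_swap, (mul_eq_zero.1 h1).resolve_left (by positivity), neg_zero]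
  exact ⟨h, fun g hg => h g fun f => by rw [inderForm_comm, hg]⟩

/-- The Casimir computation that determines the factor between the two invariant forms. -/
theorem finrank_mul_eq_of_killingForm_eq (P : SymplecticPlane ℝ V) (hS : S.IsSimple) {r : ℝ}
    (hr : killingForm ℝ S.inder = r • inderForm S) :
    (Module.finrank ℝ T + 4) * (1 - r) * Module.finrank ℝ S.inder
      = (Module.finrank ℝ T * (Module.finrank ℝ T + 1) : ℝ) := by
  let e := Module.finBasis ℝ T
  let ev (j) : S.inder →ₗ[ℝ] T := LinearMap.applyₗ (e j) ∘ₗ S.inder.toSubmodule.subtype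
  let D (j) : T →ₗ[ℝ] S.inder := S.d.flip (hS.dualBasis e j)
  have hdual : ∀ j, S.form (hS.dualBasis e j) (e j) = 1 := fun j => by
    rw [form_dualBasis_left, Module.Basis.repr_self, Finsupp.single_eq_same]
  -- The operator is `g ↦ ∑ d_{g(eⱼ),eʲ}`, with `eʲ` the dual basis. Its pairing with `f` is `2(n +
  -- 4) tr(fg)`, and `2 tr(fg) = (1 - r) inderForm(f, g)` by hypothesis.
  have h1 : ∑ j, D j ∘ₗ ev j = ((Module.finrank ℝ T + 4) * (1 - r)) • LinearMap.id := by
    ext1 g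
    have hK := inderForm_nondegenerate P hS
    rw [← sub_eq_zero]
    refine hK.2 _ fun f => ?_
    have h2 : ∀ j, inderForm S f (D j (ev j g)) = 2 * (Module.finrank ℝ T + 4)
        * S.form (hS.dualBasis e j)
          (((f : Module.End ℝ T) ∘ₗ (g : Module.End ℝ T)) (e j)) := by
      intro j
      have h3 := S.inder_form f ((g : Module.End ℝ T) (e j)) (hS.dualBasis e j)
      change inderForm S f (S.d ((g : Module.End ℝ T) (e j)) (hS.dualBasis e j)) = _
      rw [inderForm_d P hS, LinearMap.comp_apply, S.form_swap (hS.dualBasis e j)]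
      linear_combination (2 * (Module.finrank ℝ T + 4) : ℝ) * h3
    have h4 := LinearMap.congr_fun₂ hr f g
    rw [LinearMap.smul_apply, LinearMap.smul_apply, smul_eq_mul] at h4
    have h5 := inderForm_apply f g
    rw [h4] at h5
    simp only [LinearMap.sum_apply, LinearMap.comp_apply, map_sub, map_sum, LinearMap.smul_apply,
      LinearMap.id_apply, map_smul, smul_eq_mul] at h2 ⊢
    simp only [h2, ← Finset.mul_sum]
    have h6 := trace_eq_sum_form_dualBasis hS e ((f : Module.End ℝ T) ∘ₗ (g : Module.End ℝ T))
    simp only [LinearMap.comp_apply] at h6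
    rw [← h6]
    linear_combination -(Module.finrank ℝ T + 4 : ℝ) * h5
  have h2 := congrArg (LinearMap.trace ℝ S.inder) h1
  -- Composed in the other order, the maps give `x ↦ [x,eʲ,eⱼ]` on `T`, whose trace is known from
  -- `trace_triple`.
  have h3 : ∀ j, LinearMap.trace ℝ S.inder (D j ∘ₗ ev j) = Module.finrank ℝ T + 1 := by
    intro j
    rw [LinearMap.trace_comp_comm']
    have := trace_triple hS (hS.dualBasis e j) (e j)
    rw [hdual, mul_one] at this
    exact this
  rw [map_sum, Finset.sum_congr rfl fun j _ => h3 j, map_smul, LinearMap.trace_id] at h2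
  simp only [Finset.sum_const, Finset.card_univ, Fintype.card_fin, nsmul_eq_mul, smul_eq_mul] at h2
  exact h2.symm

theorem signature_inderForm (P : SymplecticPlane ℝ V) (hS : S.IsSimple)
    (hh : LieAlgebra.IsSimple ℝ S.inder) :
    signature (LinearMap.BilinMap.toQuadraticMap (inderForm S)) = killingSignature S.inder := by
  rcases hh.eq_smul_or_signature_eq_zero (B := killingForm ℝ S.inder)
    (inderForm_nondegenerate P hS) inderForm_comm (fun f g => LieModule.traceForm_comm ..)
    inderForm_lie (fun f g k => LieModule.traceForm_apply_lie_apply ..) with ⟨r, hr⟩ | ⟨h1, h2⟩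
  · have h := finrank_mul_eq_of_killingForm_eq P hS hr
    have hlt : (Module.finrank ℝ T * (Module.finrank ℝ T + 1) : ℝ)
        < (Module.finrank ℝ T + 4) * Module.finrank ℝ S.inder := by
      exact_mod_cast finrank_mul_lt hS hh
    -- If `r ≤ 0`, the Casimir identity would give `n(n + 1) ≥ (n + 4) dim 𝔥`, against the dimension
    -- bound.
    have hpos : 0 < r := by
      by_contra! hr
      have : (0 : ℝ) ≤ (Module.finrank ℝ T + 4) * Module.finrank ℝ S.inder := by positivity
      nlinarith
    change _ = signature (LinearMap.BilinMap.toQuadraticMap (killingForm ℝ S.inder))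
    rw [hr]
    exact (signature_smul _ hpos).symm
  · rw [h1]
    exact h2.symm

end SymplecticTripleSystem
end

/-- If the inner derivation algebra of a real simple symplectic triple system is simple, then the
signature of the Killing form of the standard enveloping algebra exceeds that of the inner
derivation algebra by one. -/
theorem mainTheorem7 {T V : Type*} [AddCommGroup T] [Module ℝ T] [FiniteDimensional ℝ T]
    [AddCommGroup V] [Module ℝ V]
    (S : SymplecticTripleSystem ℝ T) (P : SymplecticPlane ℝ V)
    (hS : S.IsSimple) (hh : LieAlgebra.IsSimple ℝ S.inder) :
    killingSignature (S.EnvelopingAlgebra P) - killingSignature S.inder = 1 := by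
  have := P.finiteDimensional
  rw [SymplecticTripleSystem.EnvelopingAlgebra.killingSignature_eq hS,
    SymplecticTripleSystem.signature_inderForm P hS hh]
  ring
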